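/- Let $G$ be $\mathbb{R}^d$ with Lebesgue measure or $\mathbb{Z}^d$ with counting measure, where $d\ge 1$. A function $f:G\to\mathbb{C}$ is positive definite if $\sum_{n,m=1}^N c_n\overline{c_m}f(x_n-x_m)\ge 0$ for all $N$, all $x_1,\dots,x_N\in G$ and all $c_1,\dots,c_N\in\mathbb{C}$. For an open set $\Omega\subseteq G$ the Turán constant $\mathcal{T}_G(\Omega)$ is the supremum of $\int_G f/f(0)$ over all continuous, integrable, positive definite $f:G\to\mathbb{C}$ with $f(0)\neq 0$ whose closed support is contained in $\Omega$ (with $\sup\emptyset=-\infty$). Theorem. (i) If $\Omega\subseteq\mathbb{R}^d$ is open with finite measure $m$, then $\mathcal{T}_{\mathbb{R}^d}(\Omega)\le m/2$. (ii) If $\Omega\subseteq\mathbb{Z}^d$ is finite and contains $0$, then $\mathcal{T}_{\mathbb{Z}^d}(\Omega)\le m^+$, where $m^+$ is the number of points of $\Omega$ with nonnegative first coordinate. (iii) Consequently intervals maximize the Turán constant in $\mathbb{R}$ and $\mathbb{Z}$ for given measure: for every $a>0$, $\mathcal{T}_{\mathbb{R}}((-a,a))=a$, and $\mathcal{T}_{\mathbb{R}}(\Omega)\le\mathcal{T}_{\mathbb{R}}((-a,a))$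 for every open $\Omega\subseteq\mathbb{R}$ of measure $2a$; for every integer $N\ge 0$, $\mathcal{T}_{\mathbb{Z}}(\{-N,\dots,N\})=N+1$, and $\mathcal{T}_{\mathbb{Z}}(\Omega)\le\mathcal{T}_{\mathbb{Z}}(\{-N,\dots,N\})$ for every $\Omega\subseteq\mathbb{Z}$ with $2N+1$ elements that contains $0$. -/

import Mathlib

open MeasureTheory
open scoped ComplexOrder

/-- A function `f : G → ℂ` on an abelian group is positive definite if
`∑ n, ∑ m, c n * conj (c m) * f (x n - x m)` is a nonnegative real number for all finite families of
points `x n` and complex coefficients `c n` (the order on `ℂ` is the one for which `0 ≤ z` means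
that `z` is real and nonnegative). -/
def IsPositiveDefinite {G : Type*} [AddCommGroup G] (f : G → ℂ) : Prop :=
  ∀ (N : ℕ) (x : Fin N → G) (c : Fin N → ℂ),
    0 ≤ ∑ n, ∑ m, c n * (starRingEnd ℂ) (c m) * f (x n - x m)

/-- The functions admitted in Turan's problem for `Ω`: continuous, integrable, positive definite,
with closed support contained in `Ω`. -/
structure TuranAdmissible {G : Type*} [AddCommGroup G] [TopologicalSpace G] [MeasurableSpace G]
    (μ : Measure G) (Ω : Set G) (f : G → ℂ) : Prop where
  continuous : Continuous f
  integrable : Integrable f μ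
  posDef : IsPositiveDefinite f
  tsupport_subset : tsupport f ⊆ Ω

/-- The Turan constant of `Ω` with respect to the Haar measure `μ`: the supremum, in the extended
reals, of `(∫ f) / f 0` over the admissible `f` with `f 0 ≠ 0`. This quotient is real, by
the symmetry `f (-x) = conj (f x)` of positive definite functions. -/
noncomputable def turanConstant {G : Type*} [AddCommGroup G] [TopologicalSpace G]
    [MeasurableSpace G] (μ : Measure G) (Ω : Set G) : EReal :=
  sSup {t : EReal | ∃ f : G → ℂ, TuranAdmissible μ Ω f ∧ f 0 ≠ 0 ∧
    t = ((((∫ x, f x ∂μ) / f 0).re : ℝ) : EReal)}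

/-! The discrete bound is a colouring argument. On a finite set `s`, join distinct points whose
differences in both orders lie in `Ω`. Added in order of increasing first coordinate, each point
meets at most `m - 1` earlier neighbours, where `m` counts the elements of `Ω` with nonnegative
first coordinate, so `m` colours suffice (`exists_greedy_coloring`). Testing positive definiteness
on the colour classes, each centred by subtracting `1 / m`, gives `∑ f (x - y) ≤ m * |s| * f 0`
(`IsPositiveDefinite.sum_sub_re_le`). With `s` a growing box, dividing by `|s|` yields `∑ f ≤ m * f
0` (`IsPositiveDefinite.sum_re_le`).

In `ℝ ^ d`, for compact support, this is applied to the restriction of `f` to `ℤ ^ d / n`, and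
Riemann sums pass to the limit. The count `m` becomes the volume of the half of the support with `0
≤ x 0`, which by symmetry is at most half of the total. Multiplying by wide triangle functions
reduces the general case to compact support. The triangle functions are also the examples attaining
or approaching the bound on intervals. -/

open Filter Topology Pointwise

/-! ### Elementary properties of positive definite functions -/

namespace IsPositiveDefinite

variable {G : Type*} [AddCommGroup G] {f : G → ℂ}

theorem finset_sum_nonneg (hf : IsPositiveDefinite f) (s : Finset G) (c : G → ℂ) :
    0 ≤ ∑ x ∈ s, ∑ y ∈ s, c x * (starRingEnd ℂ) (c y) * f (x - y) := by
  have h := hf s.card (fun i => (s.equivFin.symm i : G)) (fun i => c (s.equivFin.symm i : G))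
  have key : ∀ g : G → ℂ, ∑ i, g (s.equivFin.symm i : G) = ∑ x ∈ s, g x := fun g => by
    rw [← Finset.sum_coe_sort s g]
    exact Equiv.sum_comp s.equivFin.symm (fun x : s => g x)
  have h2 : ∀ n : Fin s.card, ∑ m : Fin s.card, c (s.equivFin.symm n : G) *
      (starRingEnd ℂ) (c (s.equivFin.symm m : G)) *
        f ((s.equivFin.symm n : G) - (s.equivFin.symm m : G)) =
      ∑ y ∈ s, c (s.equivFin.symm n : G) * (starRingEnd ℂ) (c y) *
        f ((s.equivFin.symm n : G) - y) := fun n =>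
    key (fun y => c (s.equivFin.symm n : G) * (starRingEnd ℂ) (c y) *
        f ((s.equivFin.symm n : G) - y))
  simp only [h2] at h
  rwa [key (fun x => ∑ y ∈ s, c x * (starRingEnd ℂ) (c y) * f (x - y))] at h

theorem apply_zero_nonneg (hf : IsPositiveDefinite f) : 0 ≤ f 0 := by
  simpa using hf 1 (fun _ => 0) (fun _ => 1)

theorem apply_neg (hf : IsPositiveDefinite f) (x : G) : f (-x) = (starRingEnd ℂ) (f x) := by
  have h0 := (Complex.nonneg_iff.mp hf.apply_zero_nonneg).2
  -- Reality of the form for coefficients `(1, 1)` matches the imaginary parts, for `(I, 1)` the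
  -- real parts.
  have h1 := (Complex.nonneg_iff.mp (hf 2 ![x, 0] ![1, 1])).2
  have h2 := (Complex.nonneg_iff.mp (hf 2 ![x, 0] ![Complex.I, 1])).2
  simp [Fin.sum_univ_two] at h1 h2
  apply Complex.ext <;> simp <;> linarith

theorem comp_addMonoidHom {H : Type*} [AddCommGroup H] (hf : IsPositiveDefinite f) (φ : H →+ G) :
    IsPositiveDefinite (fun x => f (φ x)) := by
  intro N x c
  simpa using hf N (fun n => φ (x n)) c

theorem one : IsPositiveDefinite (fun _ : G => (1 : ℂ)) := by
  intro N x c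
  have : ∑ n, ∑ m, c n * (starRingEnd ℂ) (c m) * 1 = (∑ n, c n) * star (∑ n, c n) := by
    simp [Finset.sum_mul_sum, star_sum]
  rw [this]
  exact mul_star_self_nonneg _

theorem apply_zero_re_pos (hf : IsPositiveDefinite f) (h : f 0 ≠ 0) : 0 < (f 0).re := by
  obtain ⟨h1, h2⟩ := Complex.nonneg_iff.mp hf.apply_zero_nonneg
  refine lt_of_le_of_ne h1 fun h3 => h (Complex.ext h3.symm h2.symm)

theorem div_apply_zero_re (hf : IsPositiveDefinite f) (z : ℂ) :
    (z / f 0).re = z.re / (f 0).re := by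
  have h : f 0 = ((f 0).re : ℂ) :=
    Complex.ext rfl (Complex.nonneg_iff.mp hf.apply_zero_nonneg).2.symm
  rw [h, Complex.div_ofReal_re, Complex.ofReal_re]

end IsPositiveDefinite

/-! ### Triangle functions as positive definite multipliers -/

/-- The triangle function of width `b`, the autocorrelation of the indicator of an interval. -/
def triangle (b x : ℝ) : ℝ := max (b - |x|) 0

theorem continuous_triangle (b : ℝ) : Continuous (triangle b) := by
  unfold triangle; fun_prop

theorem triangle_nonneg (b x : ℝ) : 0 ≤ triangle b x := le_max_right _ _

theorem triangle_eq_zero {b x : ℝ} (h : b ≤ |x|) : triangle b x = 0 :=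
  max_eq_right (by linarith)

theorem triangle_of_abs_le {b x : ℝ} (h : |x| ≤ b) : triangle b x = b - |x| :=
  max_eq_left (by linarith)

theorem integral_indicator_mul_indicator_Ico (b u v : ℝ) :
    ∫ t, (Set.Ico u (u + b)).indicator (fun _ => (1 : ℂ)) t *
      (Set.Ico v (v + b)).indicator (fun _ => (1 : ℂ)) t = (triangle b (u - v) : ℂ) := by
  have h : (fun t => (Set.Ico u (u + b)).indicator (fun _ => (1 : ℂ)) t *
      (Set.Ico v (v + b)).indicator (fun _ => (1 : ℂ)) t) =
      (Set.Ico u (u + b) ∩ Set.Ico v (v + b)).indicator (fun _ => (1 : ℂ)) := by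
    ext t
    simp only [Set.indicator_apply, Set.mem_inter_iff]
    split_ifs <;> simp_all
  rw [h, integral_indicator (measurableSet_Ico.inter measurableSet_Ico), Set.Ico_inter_Ico,
    setIntegral_const, Real.volume_real_Ico, Complex.real_smul, mul_one]
  congr 1
  rw [triangle, min_add_add_right]
  congr 1
  have h1 := max_sub_min_eq_abs u v
  have h2 : |v - u| = |u - v| := abs_sub_comm _ _
  change min u v + b - max u v = b - |u - v|
  linarith

/-- The triangle at `φ (x n) - φ (x m)` is the integral of `χ n t * χ m t`. For fixed `t` these
factors are absorbed into the coefficients, so the form is an integral of nonnegative forms of `f`.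
-/
theorem IsPositiveDefinite.mul_triangle {G : Type*} [AddCommGroup G] {f : G → ℂ}
    (hf : IsPositiveDefinite f) (b : ℝ) (φ : G →+ ℝ) :
    IsPositiveDefinite (fun x => f x * (triangle b (φ x) : ℂ)) := by
  intro N x c
  set χ : Fin N → ℝ → ℂ := fun n => (Set.Ico (φ (x n)) (φ (x n) + b)).indicator (fun _ => 1)
    with hχ
  have hreal : ∀ n t, (starRingEnd ℂ) (χ n t) = χ n t := by
    intro n t
    simp only [hχ, Set.indicator_apply]
    split_ifs <;> simp
  have hint : ∀ n m, Integrable (fun t => χ n t * χ m t) := by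
    intro n m
    have h1 : ∀ n, Integrable (χ n) := fun n =>
      (integrable_indicator_iff measurableSet_Ico).2
        (integrableOn_const (by simp) (by simp))
    refine (h1 m).bdd_mul (c := 1) (h1 n).aestronglyMeasurable (Filter.Eventually.of_forall ?_)
    intro t
    simp only [hχ, Set.indicator_apply]
    split_ifs <;> simp
  have key : ∑ n, ∑ m, c n * (starRingEnd ℂ) (c m) *
      (f (x n - x m) * (triangle b (φ (x n - x m)) : ℂ)) =
      ∫ t, ∑ n, ∑ m, (c n * χ n t) * (starRingEnd ℂ) (c m * χ m t) * f (x n - x m) := by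
    have e : ∀ t n m, (c n * χ n t) * (starRingEnd ℂ) (c m * χ m t) * f (x n - x m) =
        (c n * (starRingEnd ℂ) (c m) * f (x n - x m)) * (χ n t * χ m t) := by
      intro t n m
      rw [map_mul, hreal]; ring
    simp only [e]
    rw [integral_finsetSum _ fun n _ => integrable_finsetSum _ fun m _ => (hint n m).const_mul _]
    refine Finset.sum_congr rfl fun n _ => ?_
    rw [integral_finsetSum _ fun m _ => (hint n m).const_mul _]
    refine Finset.sum_congr rfl fun m _ => ?_
    rw [integral_const_mul, integral_indicator_mul_indicator_Ico, map_sub]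
    ring
  change 0 ≤ ∑ n, ∑ m, c n * (starRingEnd ℂ) (c m) *
      (f (x n - x m) * (triangle b (φ (x n - x m)) : ℂ))
  rw [key]
  exact integral_nonneg fun t => hf N x fun n => c n * χ n t

/-! ### The colouring bound on finite sets -/

/-- Greedy colouring: if the points of `s` are listed in order of increasing height `φ`, each is
in conflict with fewer earlier ones than there are elements of nonnegative height in `Ω`. -/
theorem exists_greedy_coloring {G : Type*} [AddCommGroup G] [DecidableEq G] (φ : G →+ ℤ)
    (Ω : Finset G) (h0 : 0 ∈ Ω) (s : Finset G) :
    ∃ c : G → Fin (Ω.filter (fun x => 0 ≤ φ x)).card,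
      ∀ x ∈ s, ∀ y ∈ s, x ≠ y → x - y ∈ Ω → y - x ∈ Ω → c x ≠ c y := by
  have hpos : 0 < (Ω.filter (fun x => 0 ≤ φ x)).card :=
    Finset.card_pos.2 ⟨0, by simp [h0]⟩
  induction s using Finset.induction_on_max_value φ with
  | empty => exact ⟨fun _ => ⟨0, hpos⟩, by simp⟩
  | insert a s ha hmax ih =>
    obtain ⟨c, hc⟩ := ih
    set P := (Ω.filter (fun x => 0 ≤ φ x)).erase 0 with hP
    -- Earlier neighbours of `a` have the form `a - k` with `k ∈ P`. Erasing `0` makes `P` smaller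
    -- than the palette, so a colour is free.
    obtain ⟨i, hi⟩ : ∃ i, i ∉ P.image (fun k => c (a - k)) := by
      by_contra! h
      have h1 : (Finset.univ : Finset (Fin (Ω.filter (fun x => 0 ≤ φ x)).card)).card ≤
          (P.image (fun k => c (a - k))).card := Finset.card_le_card fun i _ => h i
      have h2 : (P.image (fun k => c (a - k))).card ≤ P.card := Finset.card_image_le
      have h3 : P.card < (Ω.filter (fun x => 0 ≤ φ x)).card :=
        Finset.card_erase_lt_of_mem (by simp [h0])
      rw [Finset.card_univ, Fintype.card_fin] at h1
      omega
    have hconf : ∀ y ∈ s, a - y ∈ Ω → c y ≠ i := by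
      intro y hy hay hcy
      refine hi (Finset.mem_image.2 ⟨a - y, ?_, by simpa using hcy⟩)
      have hne : a ≠ y := fun h => ha (h ▸ hy)
      simp only [hP, Finset.mem_erase, Finset.mem_filter, map_sub, sub_nonneg]
      exact ⟨sub_ne_zero.2 hne, hay, hmax y hy⟩
    refine ⟨Function.update c a i, ?_⟩
    intro x hx y hy hxy h1 h2
    have hne : ∀ z ∈ s, z ≠ a := fun z hz h => ha (h ▸ hz)
    rcases Finset.mem_insert.1 hx with hxa | hxs <;> rcases Finset.mem_insert.1 hy with hya | hys
    · exact absurd (hxa.trans hya.symm) hxy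
    · rw [hxa, Function.update_self, Function.update_of_ne (hne y hys)]
      exact (hconf y hys (hxa ▸ h1)).symm
    · rw [hya, Function.update_self, Function.update_of_ne (hne x hxs)]
      exact hconf x hxs (hya ▸ h2)
    · rw [Function.update_of_ne (hne x hxs), Function.update_of_ne (hne y hys)]
      exact hc x hxs y hys hxy h1 h2

/-- If `f` vanishes at the differences of distinct points of equal colour, its double sum over a
finite set is at most the number of colours times the diagonal. -/
theorem IsPositiveDefinite.sum_sub_re_le {G : Type*} [AddCommGroup G] {f : G → ℂ}
    (hf : IsPositiveDefinite f) (s : Finset G) {N : ℕ} (c : G → Fin N)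
    (hc : ∀ x ∈ s, ∀ y ∈ s, x ≠ y → c x = c y → f (x - y) = 0) (hN : 0 < N) :
    (∑ x ∈ s, ∑ y ∈ s, f (x - y)).re ≤ N * (s.card * (f 0).re) := by
  classical
  have hN' : (N : ℂ) ≠ 0 := by exact_mod_cast hN.ne'
  -- Centring makes the products of coefficients, summed over the colours, equal to `1 - 1 / N` for
  -- equal colours and `-1 / N` otherwise. Since `f` kills equally coloured pairs off the diagonal,
  -- only the diagonal and `-1 / N` times the full double sum survive.
  have h1 : 0 ≤ ∑ i : Fin N, ∑ x ∈ s, ∑ y ∈ s, ((if c x = i then (1 : ℂ) else 0) - (N : ℂ)⁻¹) *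
      (starRingEnd ℂ) ((if c y = i then (1 : ℂ) else 0) - (N : ℂ)⁻¹) * f (x - y) :=
    Finset.sum_nonneg fun i _ =>
      hf.finset_sum_nonneg s fun x => (if c x = i then (1 : ℂ) else 0) - (N : ℂ)⁻¹
  have h2 : ∀ x y, ∑ i : Fin N, ((if c x = i then (1 : ℂ) else 0) - (N : ℂ)⁻¹) *
      (starRingEnd ℂ) ((if c y = i then (1 : ℂ) else 0) - (N : ℂ)⁻¹) =
      (if c x = c y then 1 else 0) - (N : ℂ)⁻¹ := by
    intro x y
    have e : ∀ i : Fin N, ((if c x = i then (1 : ℂ) else 0) - (N : ℂ)⁻¹) *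
      (starRingEnd ℂ) ((if c y = i then (1 : ℂ) else 0) - (N : ℂ)⁻¹) =
      (if c x = i then (if c y = i then 1 else 0) else 0) - (N : ℂ)⁻¹ * (if c x = i then 1 else 0)
        - (N : ℂ)⁻¹ * (if c y = i then 1 else 0) + (N : ℂ)⁻¹ * (N : ℂ)⁻¹ := by
      intro i
      split_ifs <;> simp <;> ring
    rw [Finset.sum_congr rfl fun i _ => e i]
    simp only [Finset.sum_add_distrib, Finset.sum_sub_distrib, ← Finset.mul_sum,
      Finset.sum_ite_eq, Finset.sum_ite_eq', Finset.mem_univ, if_true, Finset.sum_const, Finset.card_univ,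
      Fintype.card_fin, nsmul_eq_mul, eq_comm (a := c y)]
    field_simp
    ring
  have h3 : ∑ i : Fin N, ∑ x ∈ s, ∑ y ∈ s, ((if c x = i then (1 : ℂ) else 0) - (N : ℂ)⁻¹) *
      (starRingEnd ℂ) ((if c y = i then (1 : ℂ) else 0) - (N : ℂ)⁻¹) * f (x - y) =
      s.card * f 0 - (N : ℂ)⁻¹ * ∑ x ∈ s, ∑ y ∈ s, f (x - y) := by
    rw [Finset.sum_comm]
    have e : ∀ x ∈ s, ∑ i : Fin N, ∑ y ∈ s, ((if c x = i then (1 : ℂ) else 0) - (N : ℂ)⁻¹) *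
      (starRingEnd ℂ) ((if c y = i then (1 : ℂ) else 0) - (N : ℂ)⁻¹) * f (x - y) =
      f 0 - (N : ℂ)⁻¹ * ∑ y ∈ s, f (x - y) := by
      intro x hx
      rw [Finset.sum_comm]
      simp_rw [← Finset.sum_mul, h2]
      simp only [sub_mul, Finset.sum_sub_distrib, ← Finset.mul_sum]
      congr 1
      rw [Finset.sum_eq_single x]
      · simp
      · intro y hy hyx
        split_ifs with h
        · rw [hc x hx y hy hyx.symm h, mul_zero]
        · rw [zero_mul]
      · exact fun h => absurd hx h
    rw [Finset.sum_congr rfl e, Finset.sum_sub_distrib, ← Finset.mul_sum, Finset.sum_const,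
      nsmul_eq_mul]
  rw [h3] at h1
  have h4 := (Complex.nonneg_iff.mp h1).1
  have h5 : ((s.card : ℂ) * f 0 - (N : ℂ)⁻¹ * ∑ x ∈ s, ∑ y ∈ s, f (x - y)).re =
      s.card * (f 0).re - (N : ℝ)⁻¹ * (∑ x ∈ s, ∑ y ∈ s, f (x - y)).re := by
    rw [Complex.sub_re, ← Complex.ofReal_natCast, ← Complex.ofReal_natCast, ← Complex.ofReal_inv,
      Complex.re_ofReal_mul, Complex.re_ofReal_mul]
  rw [h5, sub_nonneg, inv_mul_le_iff₀ (by exact_mod_cast hN)] at h4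
  exact h4

/-! ### Averaging over boxes in `ℤ ^ d` -/

theorem sum_sum_sub_eq_sum_card_mul {G : Type*} [AddCommGroup G] [DecidableEq G] {f : G → ℂ}
    (Ω : Finset G) (hΩ : ∀ x ∉ Ω, f x = 0) (s : Finset G) :
    ∑ x ∈ s, ∑ y ∈ s, f (x - y) = ∑ k ∈ Ω, ((s.filter (fun x => x - k ∈ s)).card : ℂ) * f k := by
  have h : ∀ x, ∑ y ∈ s, f (x - y) = ∑ k ∈ Ω, if x - k ∈ s then f k else 0 := by
    intro x
    have h1 : ∑ y ∈ s, f (x - y) = ∑ y ∈ s.filter (fun y => x - y ∈ Ω), f (x - y) := by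
      rw [Finset.sum_filter]
      refine Finset.sum_congr rfl fun y _ => ?_
      split_ifs with h
      · rfl
      · exact hΩ _ h
    rw [h1, ← Finset.sum_filter]
    refine Finset.sum_nbij' (fun y => x - y) (fun y => x - y) ?_ ?_ ?_ ?_ ?_ <;> simp +contextual
  simp only [h]
  rw [Finset.sum_comm]
  refine Finset.sum_congr rfl fun k _ => ?_
  rw [← Finset.sum_filter, Finset.sum_const, nsmul_eq_mul]

theorem card_Icc_neg_const (d n : ℕ) :
    (Finset.Icc (fun _ : Fin d => -(n : ℤ)) (fun _ => (n : ℤ))).card = (2 * n + 1) ^ d := by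
  rw [Pi.card_Icc]
  simp only [Int.card_Icc, Finset.prod_const, Finset.card_univ, Fintype.card_fin]
  congr 1
  omega

/-- Grouping the double sum over a box by differences `k` gives `f k` a weight equal to the number
of box points that stay in the box after subtracting `k`. Relative to the size of the box, this
tends to `1`. -/
theorem IsPositiveDefinite.sum_re_le {d : ℕ} [NeZero d] {f : (Fin d → ℤ) → ℂ}
    (hf : IsPositiveDefinite f) (Ω : Finset (Fin d → ℤ)) (h0 : 0 ∈ Ω)
    (hΩ : ∀ x ∉ Ω, f x = 0) :
    (∑ x ∈ Ω, f x).re ≤ (Ω.filter (fun x => 0 ≤ x 0)).card * (f 0).re := by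
  obtain ⟨L, hL⟩ : ∃ L : ℕ, ∀ k ∈ Ω, ∀ i, |k i| ≤ L := by
    refine ⟨∑ k ∈ Ω, ∑ i, (k i).natAbs, fun k hk i => ?_⟩
    have h1 : (k i).natAbs ≤ ∑ i, (k i).natAbs :=
      Finset.single_le_sum (f := fun i => (k i).natAbs) (fun _ _ => Nat.zero_le _)
        (Finset.mem_univ i)
    have h2 : ∑ i, (k i).natAbs ≤ ∑ k ∈ Ω, ∑ i, (k i).natAbs :=
      Finset.single_le_sum (f := fun k : Fin d → ℤ => ∑ i, (k i).natAbs)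
        (fun _ _ => Nat.zero_le _) hk
    rw [Int.abs_eq_natAbs]
    exact_mod_cast h1.trans h2
  set B : ℕ → Finset (Fin d → ℤ) := fun n =>
    Finset.Icc (fun _ : Fin d => -(n : ℤ)) (fun _ => (n : ℤ)) with hB
  have hBcard : ∀ n, (B n).card = (2 * n + 1) ^ d := fun n => card_Icc_neg_const d n
  set m := (Ω.filter (fun x => 0 ≤ x 0)).card with hm
  have hmpos : 0 < m := Finset.card_pos.2 ⟨0, by simp [h0]⟩
  have hub : ∀ n, ∑ k ∈ Ω, (((B n).filter (fun x => x - k ∈ B n)).card : ℝ) / (B n).card *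
      (f k).re ≤ m * (f 0).re := by
    intro n
    obtain ⟨c, hc⟩ := exists_greedy_coloring (Pi.evalAddMonoidHom (fun _ : Fin d => ℤ) 0) Ω h0 (B n)
    -- `Ω` need not be symmetric: by `apply_neg`, `f (x - y) ≠ 0` puts both `x - y` and `y - x` in
    -- `Ω`, which is the conflict relation of the colouring.
    have h1 := hf.sum_sub_re_le (B n) c (fun x hx y hy hxy hcxy => by
      by_contra hne
      refine hc x hx y hy hxy (by_contra fun h => hne (hΩ _ h))
        (by_contra fun h => hne ?_) hcxy
      rw [← neg_sub y x, hf.apply_neg, hΩ _ h, map_zero]) hmpos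
    rw [sum_sum_sub_eq_sum_card_mul Ω hΩ, Complex.re_sum] at h1
    have hBpos : (0 : ℝ) < (B n).card := by rw [hBcard]; positivity
    have h2 : ∀ k ∈ Ω, (((B n).filter (fun x => x - k ∈ B n)).card : ℝ) / (B n).card * (f k).re =
        ((((B n).filter (fun x => x - k ∈ B n)).card : ℂ) * f k).re / (B n).card := by
      intro k _
      rw [← Complex.ofReal_natCast, Complex.re_ofReal_mul]
      ring
    rw [Finset.sum_congr rfl h2, ← Finset.sum_div, div_le_iff₀ hBpos]
    refine h1.trans (le_of_eq ?_)
    change (m : ℝ) * _ = _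
    ring
  have hlim : ∀ k ∈ Ω, Tendsto (fun n : ℕ =>
      (((B (n + L)).filter (fun x => x - k ∈ B (n + L))).card : ℝ) / (B (n + L)).card)
      atTop (𝓝 1) := by
    intro k hk
    -- Since `L` bounds the coordinates of `k`, subtracting `k` keeps `B n` inside `B (n + L)`, so
    -- this ratio is a lower bound.
    have hlow : Tendsto (fun n : ℕ => ((B n).card : ℝ) / (B (n + L)).card) atTop (𝓝 1) := by
      have h1 : Tendsto (fun n : ℕ => (1 - (2 * L : ℝ) * (1 / ((n : ℝ) + L + (n + L) + 1))) ^ d)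
          atTop (𝓝 ((1 - (2 * L : ℝ) * 0) ^ d)) := by
        refine ((tendsto_const_nhds).sub (Tendsto.const_mul _ ?_)).pow d
        refine squeeze_zero (fun n => by positivity) (fun n => ?_)
          (tendsto_one_div_add_atTop_nhds_zero_nat (𝕜 := ℝ))
        refine one_div_le_one_div_of_le (by positivity) ?_
        have : (0 : ℝ) ≤ n := by positivity
        have : (0 : ℝ) ≤ L := by positivity
        linarith
      rw [mul_zero, sub_zero, one_pow] at h1
      refine h1.congr fun n => ?_
      rw [hBcard, hBcard]
      push_cast
      rw [← div_pow]
      congr 1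
      have : (2 * ((n : ℝ) + L) + 1) ≠ 0 := by positivity
      have : ((n : ℝ) + L + (n + L) + 1) ≠ 0 := by positivity
      field_simp
      ring
    refine tendsto_of_tendsto_of_tendsto_of_le_of_le hlow tendsto_const_nhds (fun n => ?_)
      (fun n => ?_)
    · refine div_le_div_of_nonneg_right ?_ (by positivity)
      refine Nat.cast_le.2 (Finset.card_le_card fun x hx => ?_)
      simp only [hB, Finset.mem_filter, Finset.mem_Icc, Pi.le_def, Pi.sub_apply] at hx ⊢
      push_cast
      refine ⟨⟨fun i => ?_, fun i => ?_⟩, fun i => ?_, fun i => ?_⟩ <;>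
      · have h1 := abs_le.1 (hL k hk i)
        have h2 := hx.1 i
        have h3 := hx.2 i
        omega
    · exact div_le_one_of_le₀ (Nat.cast_le.2 (Finset.card_filter_le _ _)) (by positivity)
  have hlim' := tendsto_finsetSum Ω fun k hk => (hlim k hk).mul_const (f k).re
  simp only [one_mul] at hlim'
  rw [Complex.re_sum]
  exact le_of_tendsto' hlim' fun n => hub (n + L)

theorem integral_count_eq_sum {G : Type*} [MeasurableSpace G] [Countable G]
    [MeasurableSingletonClass G] {f : G → ℂ} (hf : Integrable f Measure.count) (Ω : Finset G)
    (hΩ : ∀ x ∉ Ω, f x = 0) : ∫ x, f x ∂Measure.count = ∑ x ∈ Ω, f x := by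
  rw [integral_countable hf]
  simp only [count_real_singleton, one_smul]
  exact tsum_eq_sum hΩ

theorem turanConstant_pi_int_le {d : ℕ} [NeZero d] (Ω : Finset (Fin d → ℤ)) (h0 : 0 ∈ Ω) :
    turanConstant Measure.count (Ω : Set (Fin d → ℤ)) ≤
      (((Ω.filter (fun x => 0 ≤ x 0)).card : ℝ) : EReal) := by
  refine sSup_le ?_
  rintro _ ⟨f, hf, hf0, rfl⟩
  have hΩ : ∀ x ∉ Ω, f x = 0 := fun x hx => by
    by_contra h
    exact hx (hf.tsupport_subset (subset_tsupport f h))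
  rw [EReal.coe_le_coe_iff, hf.posDef.div_apply_zero_re, integral_count_eq_sum hf.integrable Ω hΩ,
    div_le_iff₀ (hf.posDef.apply_zero_re_pos hf0)]
  exact hf.posDef.sum_re_le Ω h0 hΩ

/-! ### Riemann sums over `ℤ ^ d / n` -/

theorem mem_Icc_nat_mul_iff_div_mem_Icc {d : ℕ} (R : ℕ) {n : ℕ} (hn : 0 < n) (k : Fin d → ℤ) :
    k ∈ Finset.Icc (fun _ : Fin d => -((n * R : ℕ) : ℤ)) (fun _ => ((n * R : ℕ) : ℤ)) ↔
      (fun i => (k i : ℝ) / n) ∈ Set.Icc (fun _ : Fin d => -(R : ℝ)) (fun _ => (R : ℝ)) := by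
  have hn0 : (0 : ℝ) < n := by exact_mod_cast hn
  simp only [Finset.mem_Icc, Set.mem_Icc, Pi.le_def, div_le_iff₀ hn0, le_div_iff₀ hn0]
  refine and_congr (forall_congr' fun i => ?_) (forall_congr' fun i => ?_)
  · rw [← Int.cast_le (R := ℝ)]
    push_cast
    rw [neg_mul, mul_comm (R : ℝ)]
  · rw [← Int.cast_le (R := ℝ)]
    push_cast
    rw [mul_comm (R : ℝ)]

/-- Riemann sums over the points of `ℤ ^ d / n` in a cube converge to the integral. -/
theorem tendsto_sum_lattice_div_pow {d : ℕ} {g : (Fin d → ℝ) → ℝ} (hg : Continuous g) (R : ℕ)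
    (hR : ∀ x, x ∉ Set.Icc (fun _ : Fin d => -(R : ℝ)) (fun _ => (R : ℝ)) → g x = 0) :
    Tendsto (fun n : ℕ => (∑ k ∈ Finset.Icc (fun _ : Fin d => -((n * R : ℕ) : ℤ))
      (fun _ => ((n * R : ℕ) : ℤ)), g (fun i => (k i : ℝ) / n)) / (n : ℝ) ^ d) atTop
      (𝓝 (∫ x, g x)) := by
  set s := Set.Icc (fun _ : Fin d => -(R : ℝ)) (fun _ => (R : ℝ)) with hs
  have h := tendsto_tsum_div_pow_atTop_integral s g hg (Metric.isBounded_Icc _ _)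
    measurableSet_Icc ((convex_Icc _ _).addHaar_frontier volume)
  rw [setIntegral_eq_integral_of_forall_compl_eq_zero hR, Fintype.card_fin] at h
  refine h.congr' ?_
  filter_upwards [eventually_ge_atTop 1] with n hn
  have : NeZero n := ⟨by omega⟩
  have hn0 : (0 : ℝ) < n := by exact_mod_cast hn
  congr 1
  set t := s ∩ (n : ℝ)⁻¹ • (Submodule.span ℤ (Set.range (Pi.basisFun ℝ (Fin d))) :
    Set (Fin d → ℝ)) with ht
  have hinj : Function.Injective (fun (k : Fin d → ℤ) (i : Fin d) => (k i : ℝ) / n) := by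
    intro k l hkl
    funext i
    have := congrFun hkl i
    simp only at this
    rw [div_left_inj' hn0.ne'] at this
    exact_mod_cast this
  have hL : ∀ x : Fin d → ℝ, x ∈ (n : ℝ)⁻¹ • (Submodule.span ℤ (Set.range (Pi.basisFun ℝ (Fin d))) :
      Set (Fin d → ℝ)) ↔ ∃ k : Fin d → ℤ, (fun i => (k i : ℝ) / n) = x := by
    intro x
    have hx := BoxIntegral.unitPartition.mem_smul_span_iff (n := n) (v := x)
    refine hx.trans ⟨fun h => ?_, ?_⟩
    · choose k hk using h
      refine ⟨k, funext fun i => ?_⟩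
      have := hk i
      simp only [eq_intCast] at this
      rw [this]
      field_simp
    · rintro ⟨k, rfl⟩ i
      refine ⟨k i, ?_⟩
      simp only [eq_intCast]
      field_simp
  rw [tsum_subtype t g, ← hinj.tsum_eq]
  · have hmem := fun k => mem_Icc_nat_mul_iff_div_mem_Icc (d := d) R (by omega : 0 < n) k
    rw [tsum_eq_sum (s := Finset.Icc (fun _ : Fin d => -((n * R : ℕ) : ℤ))
      (fun _ => ((n * R : ℕ) : ℤ)))]
    · refine Finset.sum_congr rfl fun k hk => Set.indicator_of_mem ?_ _
      exact ⟨(hmem k).1 hk, (hL _).2 ⟨k, rfl⟩⟩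
    · intro k hk
      exact Set.indicator_of_notMem (fun h => hk ((hmem k).2 h.1)) _
  · intro x hx
    exact (hL x).1 (Set.mem_of_indicator_ne_zero hx).2

theorem exists_nat_forall_notMem_Icc_eq_zero {d : ℕ} {g : (Fin d → ℝ) → ℝ}
    (hg : HasCompactSupport g) :
    ∃ R : ℕ, ∀ x, x ∉ Set.Icc (fun _ : Fin d => -(R : ℝ)) (fun _ => (R : ℝ)) → g x = 0 := by
  obtain ⟨r, hr⟩ := hg.isCompact.isBounded.subset_closedBall 0
  obtain ⟨R, hR⟩ := exists_nat_ge r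
  refine ⟨R, fun x hx => by_contra fun h => hx ?_⟩
  have h1 := hr (subset_tsupport g h)
  rw [mem_closedBall_zero_iff] at h1
  have h2 : ∀ i, |x i| ≤ R := fun i => (norm_le_pi_norm x i).trans (h1.trans hR)
  exact ⟨fun i => (abs_le.1 (h2 i)).1, fun i => (abs_le.1 (h2 i)).2⟩

/-! ### The bound in `ℝ ^ d` for compact support -/

theorem IsPositiveDefinite.neg_mem_tsupport {G : Type*} [AddCommGroup G] [TopologicalSpace G]
    [ContinuousNeg G] {f : G → ℂ} (hf : IsPositiveDefinite f) {x : G} (hx : x ∈ tsupport f) :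
    -x ∈ tsupport f := by
  have h : -tsupport f = tsupport f := by
    rw [tsupport, neg_closure]
    congr 1
    ext y
    simp [hf.apply_neg]
  rwa [← h, Set.neg_mem_neg]

/-- Half of a symmetric set lies in a closed half space. -/
theorem volume_inter_halfspace_le {d : ℕ} [NeZero d] {K : Set (Fin d → ℝ)} (hK : MeasurableSet K)
    (hneg : ∀ x ∈ K, -x ∈ K) :
    2 * volume (K ∩ {x | 0 ≤ x 0}) ≤ volume K := by
  set P : Set (Fin d → ℝ) := K ∩ {x | 0 ≤ x 0} with hP
  have hhalf : MeasurableSet {x : Fin d → ℝ | 0 ≤ x 0} :=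
    measurableSet_le measurable_const (measurable_pi_apply 0)
  have hPm : MeasurableSet P := hK.inter hhalf
  have h1 : volume (-P) = volume P := Measure.measure_neg _ _
  have h2 : AEDisjoint volume P (-P) := by
    refine measure_mono_null ?_ (Measure.pi_hyperplane (fun _ : Fin d => volume) 0 0)
    rintro x ⟨⟨_, hx⟩, ⟨_, hx'⟩⟩
    simp only [Set.mem_ofPred_eq, Pi.neg_apply] at hx hx' ⊢
    linarith
  calc 2 * volume P = volume P + volume (-P) := by rw [h1, two_mul]
    _ = volume (P ∪ -P) := (measure_union₀ hPm.neg.nullMeasurableSet h2).symm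
    _ ≤ volume K := by
      refine measure_mono (Set.union_subset Set.inter_subset_left fun x hx => ?_)
      simpa using hneg _ hx.1

/-- The cutoff `φ` replaces the indicator of the half support, whose lattice points could not be
counted by Riemann sums of a continuous function. The discrete bound makes every Riemann sum of `φ *
(f 0).re - f.re` nonnegative. -/
theorem IsPositiveDefinite.integral_re_le_integral_mul {d : ℕ} [NeZero d] {f : (Fin d → ℝ) → ℂ}
    (hf : IsPositiveDefinite f) (hcont : Continuous f) (hsupp : HasCompactSupport f)
    (hf0 : f 0 ≠ 0) {φ : (Fin d → ℝ) → ℝ} (hφ : Continuous φ) (hφsupp : HasCompactSupport φ)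
    (hφ0 : ∀ x, 0 ≤ φ x) (hφ1 : ∀ x ∈ tsupport f, 0 ≤ x 0 → φ x = 1) :
    (∫ x, f x).re ≤ (∫ x, φ x) * (f 0).re := by
  have hpos := hf.apply_zero_re_pos hf0
  set g : (Fin d → ℝ) → ℝ := fun x => φ x * (f 0).re - (f x).re with hg
  have hgc : Continuous g := by fun_prop
  have hres : HasCompactSupport (fun x => (f x).re) := hsupp.comp_left (g := Complex.re) rfl
  -- Both summands are nonnegative, so one cube serves for `f` and `φ`.
  obtain ⟨R, hR⟩ := exists_nat_forall_notMem_Icc_eq_zero (hsupp.norm.add hφsupp)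
  have hRf : ∀ x, x ∉ Set.Icc (fun _ : Fin d => -(R : ℝ)) (fun _ => (R : ℝ)) → f x = 0 :=
    fun x hx => norm_eq_zero.1 (le_antisymm (by
      have := hR x hx
      simp only [Pi.add_apply] at this
      linarith [hφ0 x]) (norm_nonneg _))
  have hRφ : ∀ x, x ∉ Set.Icc (fun _ : Fin d => -(R : ℝ)) (fun _ => (R : ℝ)) → φ x = 0 :=
    fun x hx => by simpa [hRf x hx] using hR x hx
  have h1 := tendsto_sum_lattice_div_pow hgc R fun x hx => by simp [hg, hRf x hx, hRφ x hx]
  have h2 : 0 ≤ ∫ x, g x := by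
    refine ge_of_tendsto h1 ?_
    filter_upwards [eventually_ge_atTop 1] with n hn
    refine div_nonneg ?_ (by positivity)
    set S := Finset.Icc (fun _ : Fin d => -((n * R : ℕ) : ℤ)) (fun _ => ((n * R : ℕ) : ℤ)) with hS
    set ι : (Fin d → ℤ) →+ (Fin d → ℝ) :=
      AddMonoidHom.mk' (fun k i => (k i : ℝ) / n) fun k l => by
        funext i
        simp only [Pi.add_apply, Int.cast_add, add_div] with hι
    classical
    have hout : ∀ k, k ∉ S.filter (fun k => ι k ∈ tsupport f) → f (ι k) = 0 := by
      intro k hk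
      by_contra h
      have hts := subset_tsupport f h
      refine hk (Finset.mem_filter.2 ⟨?_, hts⟩)
      refine (mem_Icc_nat_mul_iff_div_mem_Icc R hn k).2 (by_contra fun h' => h ?_)
      exact hRf _ h'
    have hle := (hf.comp_addMonoidHom ι).sum_re_le (S.filter (fun k => ι k ∈ tsupport f))
      (by_contra fun h => hf0 (by simpa using hout 0 h)) hout
    rw [map_zero, Finset.sum_subset (Finset.filter_subset _ S) fun k _ hk => hout k hk,
      Complex.re_sum] at hle
    have hcard : ((((S.filter (fun k => ι k ∈ tsupport f)).filter
        (fun k => 0 ≤ k 0)).card : ℕ) : ℝ) ≤ ∑ k ∈ S, φ (ι k) := by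
      rw [Finset.card_eq_sum_ones, Nat.cast_sum]
      refine (Finset.sum_le_sum fun k hk => ?_).trans (Finset.sum_le_sum_of_subset_of_nonneg
        ((Finset.filter_subset _ _).trans (Finset.filter_subset _ S)) fun k _ _ => hφ0 (ι k))
      rw [Finset.mem_filter, Finset.mem_filter] at hk
      rw [hφ1 (ι k) hk.1.2 (div_nonneg (by exact_mod_cast hk.2) (by positivity)), Nat.cast_one]
    change 0 ≤ ∑ k ∈ S, (φ (ι k) * (f 0).re - (f (ι k)).re)
    rw [Finset.sum_sub_distrib, ← Finset.sum_mul, sub_nonneg]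
    exact hle.trans (mul_le_mul_of_nonneg_right hcard hpos.le)
  have h3 : ∫ x, g x = (∫ x, φ x) * (f 0).re - (∫ x, f x).re := by
    have hre : ∫ x, (f x).re = (∫ x, f x).re :=
      integral_re (hcont.integrable_of_hasCompactSupport hsupp)
    rw [← hre, ← integral_mul_const]
    exact integral_sub ((hφ.integrable_of_hasCompactSupport hφsupp).mul_const _)
      ((Complex.continuous_re.comp hcont).integrable_of_hasCompactSupport hres)
  linarith

/-- By outer regularity and Urysohn, the integral of the cutoff can be brought within any `ε` of the
volume of the half support. -/
theorem IsPositiveDefinite.integral_re_le_volume_tsupport {d : ℕ} [NeZero d]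
    {f : (Fin d → ℝ) → ℂ} (hf : IsPositiveDefinite f) (hcont : Continuous f)
    (hsupp : HasCompactSupport f) (hf0 : f 0 ≠ 0) :
    (∫ x, f x).re ≤ (volume (tsupport f)).toReal / 2 * (f 0).re := by
  have hpos := hf.apply_zero_re_pos hf0
  set P : Set (Fin d → ℝ) := tsupport f ∩ {x | 0 ≤ x 0} with hP
  have hPc : IsCompact P :=
    hsupp.isCompact.inter_right (isClosed_le continuous_const (continuous_apply 0))
  have hPfin : volume P ≠ ⊤ := hPc.measure_lt_top.ne
  have hhalf : (volume P).toReal ≤ (volume (tsupport f)).toReal / 2 := by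
    have h := ENNReal.toReal_mono hsupp.isCompact.measure_lt_top.ne
      (volume_inter_halfspace_le (isClosed_tsupport f).measurableSet
        fun x hx => hf.neg_mem_tsupport hx)
    rw [ENNReal.toReal_mul, ENNReal.toReal_ofNat] at h
    linarith
  refine le_trans ?_ (mul_le_mul_of_nonneg_right hhalf hpos.le)
  rw [← div_le_iff₀ hpos]
  refine le_of_forall_pos_le_add fun ε hε => ?_
  rw [div_le_iff₀ hpos]
  obtain ⟨U, hPU, hU, hUlt⟩ := hPc.exists_isOpen_lt_add (μ := volume)
    (ε := ENNReal.ofReal ε) (by simpa using hε)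
  obtain ⟨φ, hφ1, hφ0, hφs, hφI⟩ := exists_continuous_one_zero_of_isCompact hPc
    hU.isClosed_compl (Set.disjoint_compl_right_iff_subset.2 hPU)
  refine (hf.integral_re_le_integral_mul hcont hsupp hf0 φ.continuous hφs (fun x => (hφI x).1)
    fun x hx hx0 => hφ1 ⟨hx, hx0⟩).trans (mul_le_mul_of_nonneg_right ?_ hpos.le)
  have hUfin : volume U ≠ ⊤ := (hUlt.trans_le le_top).ne
  calc ∫ x, φ x ≤ ∫ x, U.indicator (fun _ => (1 : ℝ)) x := by
        refine integral_mono (φ.continuous.integrable_of_hasCompactSupport hφs)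
          ((integrable_indicator_iff hU.measurableSet).2 (integrableOn_const hUfin (by simp)))
          fun x => ?_
        by_cases hx : x ∈ U
        · rw [Set.indicator_of_mem hx]; exact (hφI x).2
        · rw [Set.indicator_of_notMem hx]; exact (hφ0 hx).le
    _ = (volume U).toReal := by
        rw [integral_indicator hU.measurableSet, setIntegral_const, smul_eq_mul, mul_one]; rfl
    _ ≤ (volume P + ENNReal.ofReal ε).toReal :=
        ENNReal.toReal_mono (by simp [hPfin]) hUlt.le
    _ = (volume P).toReal + ε := by
        rw [ENNReal.toReal_add hPfin (by simp), ENNReal.toReal_ofReal hε.le]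

/-! ### Removing compactness of the support -/

theorem IsPositiveDefinite.mul_prod_triangle {d : ℕ} {f : (Fin d → ℝ) → ℂ}
    (hf : IsPositiveDefinite f) (b : ℝ) (s : Finset (Fin d)) :
    IsPositiveDefinite (fun x => f x * ∏ i ∈ s, (triangle b (x i) : ℂ)) := by
  induction s using Finset.induction_on with
  | empty => simpa using hf
  | insert a s ha ih =>
    have h := ih.mul_triangle b (Pi.evalAddMonoidHom (fun _ : Fin d => ℝ) a)
    convert h using 2 with x
    rw [Finset.prod_insert ha]
    simp only [Pi.evalAddMonoidHom_apply]
    ring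

theorem triangle_zero {b : ℝ} (hb : 0 ≤ b) : triangle b 0 = b := by
  simp [triangle, hb]

theorem triangle_le {b : ℝ} (hb : 0 ≤ b) (x : ℝ) : triangle b x ≤ b :=
  max_le (by linarith [abs_nonneg x]) hb

theorem tendsto_triangle_div (x : ℝ) :
    Tendsto (fun n : ℕ => triangle (n + 1) x / ((n : ℝ) + 1)) atTop (𝓝 1) := by
  have h : Tendsto (fun n : ℕ => 1 - |x| * (1 / ((n : ℝ) + 1))) atTop (𝓝 (1 - |x| * 0)) :=
    tendsto_const_nhds.sub (tendsto_one_div_add_atTop_nhds_zero_nat.const_mul _)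
  rw [mul_zero, sub_zero] at h
  refine h.congr' ?_
  obtain ⟨m, hm⟩ := exists_nat_ge |x|
  filter_upwards [eventually_ge_atTop m] with n hn
  have h1 : (m : ℝ) ≤ n := by exact_mod_cast hn
  rw [triangle_of_abs_le (by linarith)]
  have : ((n : ℝ) + 1) ≠ 0 := by positivity
  field_simp

/-- The product of triangles of width `n + 1` truncates `f` to compact support without enlarging the
support. Normalised by `(n + 1) ^ d`, it lies in `[0, 1]` and tends to `1`, so dominated convergence
applies. -/
theorem IsPositiveDefinite.integral_re_le {d : ℕ} [NeZero d] {f : (Fin d → ℝ) → ℂ}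
    (hf : IsPositiveDefinite f) (hcont : Continuous f) (hint : Integrable f) (hf0 : f 0 ≠ 0)
    (hfin : volume (tsupport f) ≠ ⊤) :
    (∫ x, f x).re ≤ (volume (tsupport f)).toReal / 2 * (f 0).re := by
  have hpos := hf.apply_zero_re_pos hf0
  set h : ℕ → (Fin d → ℝ) → ℂ := fun n x => f x * ∏ i, (triangle (n + 1) (x i) : ℂ) with hh
  have hbound : ∀ n, (∫ x, h n x).re / ((n : ℝ) + 1) ^ d ≤
      (volume (tsupport f)).toReal / 2 * (f 0).re := by
    intro n
    have hn : (0 : ℝ) < (n : ℝ) + 1 := by positivity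
    have hn0 : h n 0 = ((((n : ℝ) + 1) ^ d : ℝ) : ℂ) * f 0 := by
      simp only [hh, Pi.zero_apply, triangle_zero hn.le, Finset.prod_const, Finset.card_univ,
        Fintype.card_fin]
      push_cast
      ring
    have hc : Continuous (h n) := by
      refine hcont.mul (continuous_finsetProd _ fun i _ => ?_)
      exact Complex.continuous_ofReal.comp ((continuous_triangle _).comp (continuous_apply i))
    have hs : HasCompactSupport (h n) := by
      refine HasCompactSupport.intro (isCompact_closedBall (0 : Fin d → ℝ) ((n : ℝ) + 1)) ?_
      intro x hx
      rw [mem_closedBall_zero_iff, pi_norm_le_iff_of_nonneg hn.le] at hx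
      push Not at hx
      obtain ⟨i, hi⟩ := hx
      simp only [hh]
      rw [Finset.prod_eq_zero (Finset.mem_univ i), mul_zero]
      rw [triangle_eq_zero hi.le, Complex.ofReal_zero]
    have hsub : tsupport (h n) ⊆ tsupport f := by
      refine closure_mono fun x hx => ?_
      exact left_ne_zero_of_mul hx
    have hle := (hf.mul_prod_triangle ((n : ℝ) + 1) Finset.univ).integral_re_le_volume_tsupport
      hc hs (by
        change h n 0 ≠ 0
        rw [hn0]
        exact mul_ne_zero (by exact_mod_cast (by positivity)) hf0)
    change (∫ x, h n x).re ≤ (volume (tsupport (h n))).toReal / 2 * (h n 0).re at hle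
    rw [hn0, Complex.re_ofReal_mul] at hle
    rw [div_le_iff₀ (by positivity)]
    have hv : (volume (tsupport (h n))).toReal ≤ (volume (tsupport f)).toReal :=
      ENNReal.toReal_mono hfin (measure_mono hsub)
    calc (∫ x, h n x).re ≤ (volume (tsupport (h n))).toReal / 2 * (((n : ℝ) + 1) ^ d * (f 0).re) :=
          hle
      _ ≤ (volume (tsupport f)).toReal / 2 * (((n : ℝ) + 1) ^ d * (f 0).re) := by gcongr
      _ = _ := by ring
  have hlim : Tendsto (fun n : ℕ => ∫ x, f x * ∏ i, ((triangle (n + 1) (x i) / ((n : ℝ) + 1) : ℝ) : ℂ))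
      atTop (𝓝 (∫ x, f x)) := by
    refine tendsto_integral_of_dominated_convergence (fun x => ‖f x‖) (fun n => ?_) hint.norm
      (fun n => Eventually.of_forall fun x => ?_) (Eventually.of_forall fun x => ?_)
    · refine (hcont.mul (continuous_finsetProd _ fun i _ => ?_)).aestronglyMeasurable
      exact Complex.continuous_ofReal.comp
        (((continuous_triangle _).comp (continuous_apply i)).div_const _)
    · rw [norm_mul, norm_prod]
      refine mul_le_of_le_one_right (norm_nonneg _) (Finset.prod_le_one (fun i _ => norm_nonneg _)
        fun i _ => ?_)
      have hn : (0 : ℝ) < (n : ℝ) + 1 := by positivity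
      rw [Complex.norm_real, Real.norm_of_nonneg (div_nonneg (triangle_nonneg _ _) hn.le)]
      exact div_le_one_of_le₀ (triangle_le hn.le _) hn.le
    · have h1 : Tendsto (fun n : ℕ => ∏ i, ((triangle (n + 1) (x i) / ((n : ℝ) + 1) : ℝ) : ℂ))
          atTop (𝓝 (∏ _i : Fin d, ((1 : ℝ) : ℂ))) :=
        tendsto_finsetProd _ fun i _ =>
          (Complex.continuous_ofReal.tendsto _).comp (tendsto_triangle_div (x i))
      simpa using h1.const_mul (f x)
  refine le_of_tendsto ((Complex.continuous_re.tendsto _).comp hlim) (Eventually.of_forall fun n => ?_)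
  refine le_trans (le_of_eq ?_) (hbound n)
  have e : ∀ x : Fin d → ℝ, f x * ∏ i, ((triangle (n + 1) (x i) / ((n : ℝ) + 1) : ℝ) : ℂ) =
      (((((n : ℝ) + 1) ^ d)⁻¹ : ℝ) : ℂ) * h n x := by
    intro x
    simp only [hh, Complex.ofReal_div, Finset.prod_div_distrib, Finset.prod_const,
      Finset.card_univ, Fintype.card_fin]
    push_cast
    ring
  simp only [Function.comp_apply, e]
  rw [integral_const_mul, Complex.re_ofReal_mul]
  ring

theorem turanConstant_pi_real_le {d : ℕ} [NeZero d] {Ω : Set (Fin d → ℝ)} (hfin : volume Ω < ⊤) :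
    turanConstant volume Ω ≤ (((volume Ω).toReal / 2 : ℝ) : EReal) := by
  refine sSup_le ?_
  rintro _ ⟨f, hf, hf0, rfl⟩
  have hpos := hf.posDef.apply_zero_re_pos hf0
  rw [EReal.coe_le_coe_iff, hf.posDef.div_apply_zero_re, div_le_iff₀ hpos]
  have hle := measure_mono (μ := volume) hf.tsupport_subset
  refine (hf.posDef.integral_re_le hf.continuous hf.integrable hf0
    (hle.trans_lt hfin).ne).trans ?_
  have := ENNReal.toReal_mono hfin.ne hle
  gcongr

/-! ### Upper bounds in dimension one -/

theorem turanConstant_le_turanConstant_preimage {G H : Type*} [AddCommGroup G] [TopologicalSpace G]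
    [MeasurableSpace G] [AddCommGroup H] [TopologicalSpace H] [MeasurableSpace H]
    {μ : Measure G} {ν : Measure H} (φ : G →+ H) (hφ : Continuous φ) (hmp : MeasurePreserving φ μ ν)
    (hemb : MeasurableEmbedding φ) (Ω : Set H) :
    turanConstant ν Ω ≤ turanConstant μ (φ ⁻¹' Ω) := by
  refine sSup_le ?_
  rintro _ ⟨f, hf, hf0, rfl⟩
  refine le_sSup ⟨fun x => f (φ x), ⟨hf.continuous.comp hφ, ?_, hf.posDef.comp_addMonoidHom φ, ?_⟩,
    by simpa using hf0, ?_⟩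
  · exact (hmp.integrable_comp_emb hemb).2 hf.integrable
  · exact (tsupport_comp_subset_preimage f hφ).trans (Set.preimage_mono hf.tsupport_subset)
  · rw [hmp.integral_comp hemb]
    simp only [map_zero]

theorem turanConstant_real_le {Ω : Set ℝ} (hfin : volume Ω < ⊤) :
    turanConstant volume Ω ≤ (((volume Ω).toReal / 2 : ℝ) : EReal) := by
  have hmp := volume_preserving_funUnique (Fin 1) ℝ
  have hemb := (MeasurableEquiv.funUnique (Fin 1) ℝ).measurableEmbedding
  have hvol : volume ((MeasurableEquiv.funUnique (Fin 1) ℝ) ⁻¹' Ω) = volume Ω :=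
    hmp.measure_preimage_emb hemb Ω
  have h := turanConstant_le_turanConstant_preimage
    (Pi.evalAddMonoidHom (fun _ : Fin 1 => ℝ) 0) (continuous_apply 0) hmp hemb Ω
  refine h.trans ?_
  rw [← hvol]
  exact turanConstant_pi_real_le (hvol.trans_lt hfin)

theorem IsPositiveDefinite.sum_int_re_le {f : ℤ → ℂ} (hf : IsPositiveDefinite f) (Ω : Finset ℤ)
    (h0 : 0 ∈ Ω) (hΩ : ∀ x ∉ Ω, f x = 0) :
    (∑ x ∈ Ω, f x).re ≤ (Ω.filter (fun x => 0 ≤ x)).card * (f 0).re := by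
  have h := (hf.comp_addMonoidHom (Pi.evalAddMonoidHom (fun _ : Fin 1 => ℤ) 0)).sum_re_le
    (Ω.map (Equiv.funUnique (Fin 1) ℤ).symm.toEmbedding)
    (Finset.mem_map.2 ⟨0, h0, rfl⟩)
    (fun x hx => hΩ _ fun h => hx (Finset.mem_map.2 ⟨x 0, h,
      (Equiv.funUnique (Fin 1) ℤ).symm_apply_apply x⟩))
  rw [Finset.sum_map, Finset.filter_map, Finset.card_map] at h
  exact h

/-- The nonnegative and nonpositive parts of `Ω` share only `0`, so their sizes add up to `2 * N +
2` and one of them is at most `N + 1`. Reflecting `f` allows either part to be used. -/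
theorem IsPositiveDefinite.sum_int_re_le_of_card {f : ℤ → ℂ} (hf : IsPositiveDefinite f)
    (Ω : Finset ℤ) (h0 : 0 ∈ Ω) (hΩ : ∀ x ∉ Ω, f x = 0) {N : ℕ} (hN : Ω.card = 2 * N + 1) :
    (∑ x ∈ Ω, f x).re ≤ ((N : ℝ) + 1) * (f 0).re := by
  have hpos := (Complex.nonneg_iff.mp hf.apply_zero_nonneg).1
  have h1 := hf.sum_int_re_le Ω h0 hΩ
  have h2 := (hf.comp_addMonoidHom (negAddMonoidHom : ℤ →+ ℤ)).sum_int_re_le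
    (Ω.map (Equiv.neg ℤ).toEmbedding) (Finset.mem_map.2 ⟨0, h0, by simp⟩)
    (fun x hx => hΩ _ fun h => hx (Finset.mem_map.2 ⟨-x, h, by simp⟩))
  rw [Finset.sum_map, Finset.filter_map, Finset.card_map] at h2
  simp only [Equiv.coe_toEmbedding, Equiv.neg_apply, negAddMonoidHom_apply, neg_neg, neg_zero,
    Function.comp_def, Left.nonneg_neg_iff] at h2
  have hcard : (Ω.filter (fun x => 0 ≤ x)).card + (Ω.filter (fun x => x ≤ 0)).card =
      2 * N + 2 := by
    rw [← Finset.card_union_add_card_inter, ← Finset.filter_or, ← Finset.filter_and,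
      Finset.filter_true_of_mem fun x _ => le_total 0 x, hN]
    have : Ω.filter (fun x => 0 ≤ x ∧ x ≤ 0) = {0} := by
      ext x
      simp only [Finset.mem_filter, Finset.mem_singleton]
      constructor
      · rintro ⟨_, h⟩; omega
      · rintro rfl; exact ⟨h0, by simp⟩
    rw [this, Finset.card_singleton]
  rcases le_total (Ω.filter (fun x => 0 ≤ x)).card (N + 1) with h | h
  · refine h1.trans (mul_le_mul_of_nonneg_right ?_ hpos)
    exact_mod_cast h
  · refine h2.trans (mul_le_mul_of_nonneg_right ?_ hpos)
    have : (Ω.filter (fun x => x ≤ 0)).card ≤ N + 1 := by omega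
    exact_mod_cast this

theorem turanConstant_int_le (Ω : Finset ℤ) (h0 : 0 ∈ Ω) {N : ℕ} (hN : Ω.card = 2 * N + 1) :
    turanConstant Measure.count (Ω : Set ℤ) ≤ (((N : ℝ) + 1 : ℝ) : EReal) := by
  refine sSup_le ?_
  rintro _ ⟨f, hf, hf0, rfl⟩
  have hΩ : ∀ x ∉ Ω, f x = 0 := fun x hx => by
    by_contra h
    exact hx (hf.tsupport_subset (subset_tsupport f h))
  rw [EReal.coe_le_coe_iff, hf.posDef.div_apply_zero_re, integral_count_eq_sum hf.integrable Ω hΩ,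
    div_le_iff₀ (hf.posDef.apply_zero_re_pos hf0)]
  exact hf.posDef.sum_int_re_le_of_card Ω h0 hΩ hN

/-! ### Triangle functions as extremal examples -/

theorem isPositiveDefinite_triangle (b : ℝ) :
    IsPositiveDefinite (fun x : ℝ => (triangle b x : ℂ)) := by
  simpa using IsPositiveDefinite.one.mul_triangle b (AddMonoidHom.id ℝ)

theorem sum_Icc_sub_abs (M : ℝ) (N : ℕ) :
    ∑ k ∈ Finset.Icc (-(N : ℤ)) N, (M - |(k : ℝ)|) = (2 * N + 1) * M - N * (N + 1) := by
  induction N with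
  | zero => simp
  | succ N ih =>
    have h : Finset.Icc (-((N + 1 : ℕ) : ℤ)) ((N + 1 : ℕ) : ℤ) =
        insert (-((N + 1 : ℕ) : ℤ)) (insert (((N + 1 : ℕ) : ℤ)) (Finset.Icc (-(N : ℤ)) N)) := by
      ext x
      simp only [Finset.mem_insert, Finset.mem_Icc]
      push_cast
      omega
    have hN : (0 : ℝ) ≤ (N : ℝ) + 1 := by positivity
    rw [h, Finset.sum_insert, Finset.sum_insert, ih]
    · push_cast
      rw [abs_neg, abs_of_nonneg hN]
      ring
    · simp only [Finset.mem_Icc]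
      push_cast
      omega
    · simp only [Finset.mem_insert, Finset.mem_Icc]
      push_cast
      omega

theorem turanConstant_Icc_int (N : ℕ) :
    turanConstant Measure.count (Set.Icc (-(N : ℤ)) (N : ℤ)) = (((N : ℝ) + 1 : ℝ) : EReal) := by
  apply le_antisymm
  · rw [← Finset.coe_Icc]
    exact turanConstant_int_le _ (by simp) (by rw [Int.card_Icc]; omega)
  · have hN : (0 : ℝ) ≤ (N : ℝ) + 1 := by positivity
    have hzero : ∀ k : ℤ, k ∉ Finset.Icc (-(N : ℤ)) N → (triangle (N + 1) (k : ℝ) : ℂ) = 0 := by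
      intro k hk
      rw [triangle_eq_zero, Complex.ofReal_zero]
      have : (N : ℤ) + 1 ≤ |k| := by
        by_contra h
        exact hk (Finset.mem_Icc.2 (abs_le.1 (by omega)))
      exact_mod_cast this
    have hint : Integrable (fun k : ℤ => (triangle (N + 1) (k : ℝ) : ℂ)) Measure.count := by
      rw [integrable_count_iff]
      exact summable_of_ne_finset_zero (s := Finset.Icc (-(N : ℤ)) N) fun k hk => by
        rw [hzero k hk, norm_zero]
    -- Width `N + 1` makes the triangle vanish first at `±(N + 1)`. Its sum is `(N + 1) ^ 2` and its
    -- value at `0` is `N + 1`.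
    refine le_sSup ⟨fun k : ℤ => (triangle (N + 1) (k : ℝ) : ℂ),
      ⟨continuous_of_discreteTopology, hint, ?_, ?_⟩, ?_, ?_⟩
    · exact (isPositiveDefinite_triangle (N + 1)).comp_addMonoidHom (Int.castAddHom ℝ)
    · rw [tsupport, closure_discrete]
      intro k hk
      rw [← Finset.coe_Icc]
      exact by_contra fun h => hk (hzero k h)
    · simp only [Int.cast_zero, triangle_zero hN]
      exact_mod_cast N.succ_ne_zero
    · rw [integral_count_eq_sum hint _ hzero]
      simp only [Int.cast_zero, triangle_zero hN]
      rw [← Complex.ofReal_sum, ← Complex.ofReal_div, Complex.ofReal_re]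
      rw [Finset.sum_congr rfl fun k hk => triangle_of_abs_le ?_, sum_Icc_sub_abs]
      · congr 1
        field_simp
        ring
      · have h1 : |k| ≤ (N : ℤ) := abs_le.2 (Finset.mem_Icc.1 hk)
        have h2 : |(k : ℝ)| ≤ N := by exact_mod_cast h1
        linarith

theorem integral_triangle {b : ℝ} (hb : 0 ≤ b) : ∫ x, triangle b x = b ^ 2 := by
  have h := integral_comp_abs (f := fun x => max (b - x) 0)
  have h1 : ∫ x in Set.Ioi (0 : ℝ), max (b - x) 0 = ∫ x in Set.Ioc (0 : ℝ) b, (b - x) := by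
    rw [← setIntegral_congr_fun (f := fun x => max (b - x) 0) measurableSet_Ioc
      fun x hx => max_eq_left (sub_nonneg.2 hx.2)]
    refine setIntegral_eq_of_subset_of_forall_sdiff_eq_zero measurableSet_Ioi
      Set.Ioc_subset_Ioi_self fun x hx => max_eq_right ?_
    by_contra h
    exact hx.2 ⟨hx.1, by linarith⟩
  rw [h1, ← intervalIntegral.integral_of_le hb] at h
  change ∫ x, triangle b x = _ at h
  rw [h, intervalIntegral.integral_sub (by simp) (by simp)]
  simp
  ring

theorem turanConstant_Ioo_real {a : ℝ} (ha : 0 < a) :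
    turanConstant volume (Set.Ioo (-a) a) = (a : EReal) := by
  apply le_antisymm
  · refine (turanConstant_real_le (by simp)).trans (le_of_eq ?_)
    rw [Real.volume_Ioo, ENNReal.toReal_ofReal (by linarith)]
    congr 1
    ring
  · refine EReal.ge_of_forall_gt_iff_ge.1 fun c hc => ?_
    have hca : c < a := by exact_mod_cast hc
    -- The closed support `[-b, b]` must fit in the open interval, so `b < a`; the term `a / 2`
    -- keeps `b` positive. The quotient for width `b` is `b ^ 2 / b = b`.
    set b := max c (a / 2) with hb
    have hb0 : 0 < b := lt_max_of_lt_right (by linarith)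
    have hba : b < a := max_lt hca (by linarith)
    refine le_trans (EReal.coe_le_coe_iff.2 (le_max_left c (a / 2))) ?_
    have hcont : Continuous (fun x : ℝ => (triangle b x : ℂ)) :=
      Complex.continuous_ofReal.comp (continuous_triangle b)
    have hsub : tsupport (fun x : ℝ => (triangle b x : ℂ)) ⊆ Set.Icc (-b) b := by
      refine closure_minimal (fun x hx => ?_) isClosed_Icc
      refine abs_le.1 (le_of_not_ge fun h => hx ?_)
      simp only [triangle_eq_zero h, Complex.ofReal_zero]
    have hcs : HasCompactSupport (fun x : ℝ => (triangle b x : ℂ)) :=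
      isCompact_Icc.of_isClosed_subset (isClosed_tsupport _) hsub
    refine le_sSup ⟨fun x : ℝ => (triangle b x : ℂ),
      ⟨hcont, hcont.integrable_of_hasCompactSupport hcs, isPositiveDefinite_triangle b,
        hsub.trans (Set.Icc_subset_Ioo (by linarith) hba)⟩, ?_, ?_⟩
    · simp only [triangle_zero hb0.le]
      exact_mod_cast hb0.ne'
    · rw [integral_complex_ofReal, integral_triangle hb0.le]
      simp only [triangle_zero hb0.le]
      rw [← Complex.ofReal_div, Complex.ofReal_re]
      rw [← hb, sq, mul_div_assoc, div_self hb0.ne', mul_one]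

theorem theorem5 :
    -- the bound in `ℝ ^ d`
    (∀ (d : ℕ) [NeZero d] (Ω : Set (Fin d → ℝ)), IsOpen Ω → volume Ω < ⊤ →
      turanConstant volume Ω ≤ (((volume Ω).toReal / 2 : ℝ) : EReal)) ∧
    -- the bound in `ℤ ^ d`
    (∀ (d : ℕ) [NeZero d] (Ω : Finset (Fin d → ℤ)), 0 ∈ Ω →
      turanConstant Measure.count (Ω : Set (Fin d → ℤ)) ≤
        (((Ω.filter (fun x => 0 ≤ x 0)).card : ℝ) : EReal)) ∧
    -- intervals are extremal in `ℝ`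
    (∀ a : ℝ, 0 < a →
      turanConstant volume (Set.Ioo (-a) a) = (a : EReal) ∧
      ∀ Ω : Set ℝ, IsOpen Ω → volume Ω = volume (Set.Ioo (-a) a) →
        turanConstant volume Ω ≤ turanConstant volume (Set.Ioo (-a) a)) ∧
    -- intervals are extremal in `ℤ`
    (∀ N : ℕ,
      turanConstant Measure.count (Set.Icc (-(N : ℤ)) (N : ℤ)) = (((N : ℝ) + 1 : ℝ) : EReal) ∧
      ∀ Ω : Finset ℤ, 0 ∈ Ω → Ω.card = 2 * N + 1 →
        turanConstant Measure.count (Ω : Set ℤ) ≤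
          turanConstant Measure.count (Set.Icc (-(N : ℤ)) (N : ℤ))) := by
  refine ⟨fun d _ Ω _ hfin => turanConstant_pi_real_le hfin,
    fun d _ Ω h0 => turanConstant_pi_int_le Ω h0, fun a ha => ⟨turanConstant_Ioo_real ha, ?_⟩,
    fun N => ⟨turanConstant_Icc_int N, ?_⟩⟩
  · intro Ω _ hΩ
    rw [turanConstant_Ioo_real ha]
    refine (turanConstant_real_le (by rw [hΩ]; simp)).trans (le_of_eq ?_)
    rw [hΩ, Real.volume_Ioo, ENNReal.toReal_ofReal (by linarith)]
    congr 1
    ring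
  · intro Ω h0 hcard
    rw [turanConstant_Icc_int]
    exact turanConstant_int_le Ω h0 hcard
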